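/- For each integer $n\ge 1$, choose a partition $\lambda$ of $n$ uniformly at random among all partitions of $n$, and then, given $\lambda$, choose one of the distinct part sizes of $\lambda$ uniformly at random (each distinct size counted once, regardless of its multiplicity). Let $\sigma_{n,1}$ be the chosen part size, and let $\mathbb{P}$ denote the probability measure of this two-step experiment. Then, for every real $t$ with $0<t<\infty$, $$ \lim_{n\to\infty}\mathbb{P}\left(\frac{\pi\,\sigma_{n,1}}{\sqrt{6n}}\le t\right)=1-e^{-t}. $$ That is, the distribution function of $\pi\sigma_{n,1}/\sqrt{6n}$ converges at every $t>0$ to that of the exponential distribution with parameter $1$. -/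

import Mathlib

open Filter Topology MeasureTheory

namespace PartitionSampling

/-- The set of distinct part sizes of a partition; its cardinality is the number of different
parts. -/
def distinctParts {n : ℕ} (p : Nat.Partition n) : Finset ℕ :=
  p.parts.toFinset

/-- A partition of a positive integer has at least one part. -/
theorem distinctParts_nonempty {n : ℕ} (hn : 0 < n) (p : Nat.Partition n) :
    (distinctParts p).Nonempty := by
  rw [distinctParts, Multiset.toFinset_nonempty]
  intro h
  have hs := p.parts_sum
  rw [h, Multiset.sum_zero] at hs
  omega

/-- Every set of partitions of `n` is an event. -/
instance instMeasurableSpacePartition (n : ℕ) : MeasurableSpace (Nat.Partition n) := ⊤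

/-- The two-step sampling procedure: a partition `p` of `n` is chosen uniformly at random among all
partitions of `n`; then, given `p`, a part size `k` is chosen uniformly at random among the distinct
part sizes of `p`. The outcome is the pair `(p, k)`. -/
noncomputable def procedure1 (n : ℕ+) : PMF (Nat.Partition n × ℕ) :=
  (PMF.uniformOfFintype (Nat.Partition n)).bind fun p =>
    (PMF.uniformOfFinset (distinctParts p) (distinctParts_nonempty n.pos p)).map fun k => (p, k)

/-- The probability measure of the two-step sampling procedure. -/
noncomputable def procedure1Measure (n : ℕ+) : Measure (Nat.Partition n × ℕ) :=
  (procedure1 n).toMeasure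

/-- The size of the part selected by the procedure. -/
def partSize {n : ℕ+} (ω : Nat.Partition n × ℕ) : ℕ :=
  ω.2

end PartitionSampling

namespace PartitionSampling

open Finset Real

/-! Given `p`, the chosen part size is at most `M` with probability `smallParts M p /
#(distinctParts p)`; it suffices that numerator and denominator concentrate, since the ratio lies in
`[0, 1]`. Put `q = exp (-s)` and weight each partition by `q` to its size. The multiplicities become
independent geometric variables, and the number of sizes at most `M` has mean `∑ q ^ k` over `1 ≤ k
≤ M`. With `s = growthRate / √n` and `M ≈ t √n / growthRate`, this mean is asymptotic to `(1 - exp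
(-t)) √n / growthRate`; the total number of sizes has mean asymptotic to `√n / growthRate`. No local
limit theorem is needed. A Chernoff bound (`sum_pow_smallParts_le`, `proportion_le_exp`) makes
deviations exponentially small in `√n`, whereas passing to the uniform law on partitions of `n`
costs only `exp (o(√n))`, because the number of partitions is at least `exp ((2 * growthRate - o(1))
√n)` (`eventually_exp_le_card_partition`). -/

/-! ### Partitions as vectors of multiplicities -/

theorem partition_count_le {n : ℕ} (p : Nat.Partition n) (k : ℕ) : p.parts.count k ≤ n := by
  rcases Nat.eq_zero_or_pos k with rfl | hk
  · rw [Multiset.count_eq_zero_of_notMem fun h => (p.parts_pos h).ne' rfl]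
    exact Nat.zero_le n
  · calc p.parts.count k ≤ p.parts.card := Multiset.count_le_card _ _
      _ = (p.parts.map fun _ => 1).sum := by simp
      _ ≤ (p.parts.map id).sum :=
        Multiset.sum_map_le_sum_map _ _ fun i hi => p.parts_pos hi
      _ = n := by rw [Multiset.map_id, p.parts_sum]

theorem partition_part_le {n : ℕ} (p : Nat.Partition n) {k : ℕ} (hk : k ∈ p.parts) : k ≤ n :=
  (Multiset.le_sum_of_mem hk).trans p.parts_sum.le

/-- A partition of `n` is determined by the multiplicities of `1, …, n`. -/
theorem partition_counts_injective (n : ℕ) :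
    Function.Injective fun (p : Nat.Partition n) (i : Fin n) => p.parts.count ((i : ℕ) + 1) := by
  intro p r h
  refine Nat.Partition.ext (Multiset.ext.2 fun k => ?_)
  by_cases hk : 0 < k ∧ k ≤ n
  · have := congrFun h ⟨k - 1, by omega⟩
    simpa [Nat.sub_add_cancel hk.1] using this
  · have aux : ∀ u : Nat.Partition n, u.parts.count k = 0 := fun u =>
      Multiset.count_eq_zero_of_notMem fun hm => hk ⟨u.parts_pos hm, partition_part_le u hm⟩
    rw [aux, aux]

/-- Expanding the product gives a sum over all multiplicity vectors bounded by `n`; partitions of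
`n` inject into these, and the other terms are nonnegative. -/
theorem sum_prod_count_le (n : ℕ) (a : ℕ → ℕ → ℝ) (ha : ∀ k j, 0 ≤ a k j) :
    ∑ p : Nat.Partition n, ∏ k ∈ range n, a (k + 1) (p.parts.count (k + 1)) ≤
      ∏ k ∈ range n, ∑ j ∈ range (n + 1), a (k + 1) j := by
  simp only [Finset.prod_range fun k => a (k + 1) (Multiset.count (k + 1) _)]
  rw [Finset.prod_range, Finset.prod_univ_sum]
  rw [← Finset.sum_image (s := univ)
    (g := fun (p : Nat.Partition n) (i : Fin n) => p.parts.count ((i : ℕ) + 1))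
    (f := fun x => ∏ i : Fin n, a ((i : ℕ) + 1) (x i))
    (partition_counts_injective n).injOn]
  refine Finset.sum_le_sum_of_subset_of_nonneg ?_ fun _ _ _ => prod_nonneg fun _ _ => ha _ _
  intro x hx
  obtain ⟨p, -, rfl⟩ := Finset.mem_image.1 hx
  exact Fintype.mem_piFinset.2 fun i => mem_range.2 (Nat.lt_succ_of_le (partition_count_le p _))

theorem card_multiplicities_le (N J m : ℕ) :
    #{f ∈ Fintype.piFinset fun _ : Fin N => range (J + 1) | ∑ i : Fin N, ((i : ℕ) + 1) * f i = m} ≤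
      Fintype.card (Nat.Partition m) := by
  let g : (Fin N → ℕ) → Multiset ℕ := fun f => ∑ i : Fin N, Multiset.replicate (f i) ((i : ℕ) + 1)
  have hcount : ∀ (f : Fin N → ℕ) (i : Fin N), (g f).count ((i : ℕ) + 1) = f i := by
    intro f i
    simp only [g, Multiset.count_sum', Multiset.count_replicate]
    rw [Finset.sum_eq_single i] <;> simp +contextual [Fin.ext_iff, eq_comm]
  calc _ ≤ #((univ : Finset (Nat.Partition m)).image fun p => p.parts) := by
        refine Finset.card_le_card_of_injOn g ?_ ?_
        · intro f hf
          have hf := (Finset.mem_filter.1 hf).2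
          refine Finset.mem_coe.2 (Finset.mem_image.2 ⟨⟨g f, ?_, ?_⟩, mem_univ _, rfl⟩)
          · intro i hi
            obtain ⟨j, -, hj⟩ := Multiset.mem_sum.1 hi
            rw [Multiset.eq_of_mem_replicate hj]
            omega
          · rw [← hf]
            simp [g, Multiset.sum_sum, mul_comm]
        · intro f _ f' _ h
          funext i
          rw [← hcount f i, ← hcount f' i]
          exact congrArg _ h
    _ ≤ Fintype.card (Nat.Partition m) := Finset.card_image_le

/-- Group the expanded product by total size: `n` part sizes, each at most `n` and used at most `n`
times, give a total of at most `n ^ 3`. -/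
theorem prod_geom_le_sum_card_partition (n : ℕ) {q : ℝ} (hq : 0 ≤ q) :
    ∏ k ∈ range n, ∑ j ∈ range (n + 1), q ^ ((k + 1) * j) ≤
      ∑ m ∈ range (n ^ 3 + 1), Fintype.card (Nat.Partition m) * q ^ m := by
  rw [Finset.prod_range, Finset.prod_univ_sum]
  simp only [Finset.prod_pow_eq_pow_sum]
  have hmaps : ∀ f ∈ Fintype.piFinset fun _ : Fin n => range (n + 1),
      ∑ i : Fin n, ((i : ℕ) + 1) * f i ∈ range (n ^ 3 + 1) := by
    intro f hf
    rw [mem_range, Nat.lt_succ_iff]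
    calc ∑ i : Fin n, ((i : ℕ) + 1) * f i ≤ ∑ i : Fin n, n * n := by
          refine Finset.sum_le_sum fun i _ => Nat.mul_le_mul (by omega) ?_
          exact Nat.lt_succ_iff.1 (mem_range.1 (Fintype.mem_piFinset.1 hf i))
      _ = n ^ 3 := by simp; ring
  rw [← Finset.sum_fiberwise_of_maps_to hmaps]
  refine Finset.sum_le_sum fun m _ => ?_
  rw [Finset.sum_congr rfl fun f hf => by rw [(Finset.mem_filter.1 hf).2], Finset.sum_const,
    nsmul_eq_mul]
  exact mul_le_mul_of_nonneg_right (Nat.cast_le.2 (card_multiplicities_le n n m)) (pow_nonneg hq m)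

/-- Adjoining `n - m` parts equal to 1 is injective. -/
theorem card_partition_mono : Monotone fun n => Fintype.card (Nat.Partition n) := by
  intro m n hmn
  refine Fintype.card_le_of_injective
    (fun p => ⟨p.parts + Multiset.replicate (n - m) 1, ?_, ?_⟩) ?_
  · intro i hi
    rcases Multiset.mem_add.1 hi with h | h
    · exact p.parts_pos h
    · rw [Multiset.eq_of_mem_replicate h]
      exact Nat.one_pos
  · simp [p.parts_sum, Nat.add_sub_cancel' hmn]
  · intro p r h
    exact Nat.Partition.ext (add_right_cancel (Nat.Partition.ext_iff.1 h))

theorem card_partition_pos (n : ℕ) : (0 : ℝ) < Fintype.card (Nat.Partition n) :=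
  Nat.cast_pos.2 Fintype.card_pos

/-! ### Generating function of the number of small part sizes -/

/-- The number of distinct part sizes which are at most `M`. -/
def smallParts {n : ℕ} (M : ℕ) (p : Nat.Partition n) : ℕ :=
  #{k ∈ distinctParts p | k ≤ M}

theorem prod_pow_count {n : ℕ} (p : Nat.Partition n) (q : ℝ) :
    ∏ k ∈ range n, q ^ ((k + 1) * p.parts.count (k + 1)) = q ^ n := by
  rw [Finset.prod_pow_eq_pow_sum]
  congr 1
  conv_rhs => rw [← p.parts_sum, Finset.sum_multiset_count_of_subset p.parts (Finset.Icc 1 n)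
    fun k hk => Finset.mem_Icc.2 ⟨p.parts_pos (Multiset.mem_toFinset.1 hk),
      partition_part_le p (Multiset.mem_toFinset.1 hk)⟩]
  rw [Finset.range_eq_Ico, Finset.sum_Ico_add' (fun k => k * p.parts.count k) 0 n 1]
  refine Finset.sum_congr (by ext x; simp only [Finset.mem_Ico, Finset.mem_Icc]; omega) fun k _ => ?_
  rw [smul_eq_mul, mul_comm]

theorem prod_ite_count {n M : ℕ} (hM : M ≤ n) (p : Nat.Partition n) (y : ℝ) :
    ∏ k ∈ range n, (if k < M ∧ p.parts.count (k + 1) ≠ 0 then y else 1) = y ^ smallParts M p := by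
  rw [Finset.prod_ite, Finset.prod_const, Finset.prod_const_one, mul_one, smallParts]
  congr 1
  refine Finset.card_bij (fun k _ => k + 1) ?_ ?_ ?_
  · intro k hk
    simp only [Finset.mem_filter, distinctParts, Multiset.mem_toFinset, ne_eq,
      Multiset.count_eq_zero, not_not] at hk ⊢
    exact ⟨hk.2.2, hk.2.1⟩
  · intro a _ b _ h
    omega
  · intro k hk
    simp only [Finset.mem_filter, distinctParts, Multiset.mem_toFinset] at hk
    have := p.parts_pos hk.1
    refine ⟨k - 1, ?_, by omega⟩
    simp only [Finset.mem_filter, mem_range, ne_eq, Multiset.count_eq_zero, not_not,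
      Nat.sub_add_cancel this]
    exact ⟨by omega, by omega, hk.1⟩

theorem exp_neg_pow_lt_one {s : ℝ} (hs : 0 < s) (k : ℕ) : exp (-s) ^ (k + 1) < 1 :=
  pow_lt_one₀ (exp_pos _).le (exp_lt_one_iff.2 (neg_lt_zero.2 hs)) (Nat.succ_ne_zero k)

theorem sum_geom_succ_eq {r : ℝ} (hr : r < 1) (n : ℕ) :
    ∑ k ∈ range n, r ^ (k + 1) = r / (1 - r) * (1 - r ^ n) := by
  simp only [pow_succ, ← Finset.sum_mul]
  have h : r - 1 ≠ 0 := by linarith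
  have h' : 1 - r ≠ 0 := by linarith
  rw [geom_sum_eq hr.ne]
  field_simp
  ring

theorem exp_neg_div_one_sub {x : ℝ} : exp (-x) / (1 - exp (-x)) = (exp x - 1)⁻¹ := by
  rw [exp_neg, ← one_div_one_div (exp x - 1)]
  have := exp_pos x
  rw [show 1 - (exp x)⁻¹ = (exp x - 1) / exp x by field_simp]
  rw [div_div_eq_mul_div, inv_mul_cancel₀ this.ne', one_div_one_div, one_div]

theorem sum_exp_neg_le {x : ℝ} (hx : 0 < x) (n : ℕ) :
    ∑ k ∈ range n, exp (-x) ^ (k + 1) ≤ 1 / x := by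
  have h1 : exp (-x) < 1 := exp_lt_one_iff.2 (neg_lt_zero.2 hx)
  have h2 : x ≤ exp x - 1 := by linarith [add_one_le_exp x]
  rw [sum_geom_succ_eq h1, exp_neg_div_one_sub, one_div]
  calc (exp x - 1)⁻¹ * (1 - exp (-x) ^ n) ≤ (exp x - 1)⁻¹ * 1 := by
        refine mul_le_mul_of_nonneg_left ?_ (inv_nonneg.2 (hx.le.trans h2))
        linarith [pow_pos (exp_pos (-x)) n]
    _ ≤ x⁻¹ := by rw [mul_one]; exact inv_anti₀ hx h2

theorem hasSum_inv_succ_sq :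
    HasSum (fun j : ℕ => 1 / ((j : ℝ) + 1) ^ 2) (π ^ 2 / 6) := by
  have := (hasSum_nat_add_iff' 1).2 hasSum_zeta_two
  simpa using this

/-- The expansion of the logarithm of `∏ (1 - q ^ k)⁻¹`, where `q = exp (-s)`. -/
theorem hasSum_log_euler {s : ℝ} (hs : 0 < s) (n : ℕ) :
    HasSum (fun j : ℕ => ∑ k ∈ range n, exp (-(s * (j + 1))) ^ (k + 1) / ((j : ℝ) + 1))
      (∑ k ∈ range n, -log (1 - exp (-s) ^ (k + 1))) := by
  refine hasSum_sum fun k _ => ?_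
  have h := hasSum_pow_div_log_of_abs_lt_one (x := exp (-s) ^ (k + 1))
    (by rw [abs_of_pos (pow_pos (exp_pos _) _)]; exact exp_neg_pow_lt_one hs k)
  convert h using 3 with j
  rw [← exp_nat_mul, ← exp_nat_mul, ← exp_nat_mul]
  congr 1
  push_cast
  ring

/-- The `j`-th term is at most `1 / (s * (j + 1) ^ 2)`, and these sum to `ζ(2) / s`. -/
theorem log_euler_le {s : ℝ} (hs : 0 < s) (n : ℕ) :
    ∑ k ∈ range n, -log (1 - exp (-s) ^ (k + 1)) ≤ π ^ 2 / 6 / s := by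
  refine hasSum_le (fun j => ?_) (hasSum_log_euler hs n) (hasSum_inv_succ_sq.div_const s)
  have hj : (0 : ℝ) < j + 1 := by positivity
  rw [← Finset.sum_div, div_le_iff₀ hj]
  refine (sum_exp_neg_le (mul_pos hs hj) n).trans (le_of_eq ?_)
  field_simp

theorem le_log_euler {s : ℝ} (hs : 0 < s) (n J : ℕ) :
    ∑ j ∈ range J, (∑ k ∈ range n, exp (-(s * (j + 1))) ^ (k + 1)) / ((j : ℝ) + 1) ≤
      ∑ k ∈ range n, -log (1 - exp (-s) ^ (k + 1)) := by
  simp only [Finset.sum_div]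
  refine sum_le_hasSum _ (fun j _ => Finset.sum_nonneg fun k _ => ?_) (hasSum_log_euler hs n)
  positivity

theorem geom_weight_le {Q y : ℝ} (hQ0 : 0 ≤ Q) (hQ : Q < 1) (hy : 0 ≤ y) (n : ℕ) :
    ∑ j ∈ range (n + 1), Q ^ j * (if j ≠ 0 then y else 1) ≤ (1 + (y - 1) * Q) / (1 - Q) := by
  have h : 0 < 1 - Q := by linarith
  rw [Finset.sum_range_succ']
  simp only [ne_eq, Nat.succ_ne_zero, not_false_eq_true, if_true, not_true_eq_false, if_false,
    pow_zero, mul_one, ← Finset.sum_mul]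
  rw [sum_geom_succ_eq hQ]
  calc Q / (1 - Q) * (1 - Q ^ n) * y + 1 ≤ Q / (1 - Q) * 1 * y + 1 := by
        have := pow_nonneg hQ0 n
        gcongr
        linarith
    _ = _ := by field_simp; ring

/-- An exponential moment bound: each size `k ≤ M` contributes an extra factor `1 + (y - 1) * q ^ k
≤ exp ((y - 1) * q ^ k)` to the Euler product, and `exp (s * n)` removes the weight `q ^ n`. -/
theorem sum_pow_smallParts_le {s y : ℝ} (hs : 0 < s) (hy : 0 ≤ y) {n M : ℕ} (hM : M ≤ n) :
    ∑ p : Nat.Partition n, y ^ smallParts M p ≤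
      exp (π ^ 2 / 6 / s + s * n + (y - 1) * ∑ k ∈ range M, exp (-s) ^ (k + 1)) := by
  set q := exp (-s) with hq
  have hq0 : 0 < q := exp_pos _
  have hqn : q ^ n * exp (s * n) = 1 := by
    rw [hq, ← exp_nat_mul, ← exp_add]
    simp [mul_comm]
  have key : q ^ n * ∑ p : Nat.Partition n, y ^ smallParts M p ≤
      exp (π ^ 2 / 6 / s + (y - 1) * ∑ k ∈ range M, q ^ (k + 1)) := by
    have h := sum_prod_count_le n
      (fun k j => q ^ (k * j) * if k - 1 < M ∧ j ≠ 0 then y else 1)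
      (fun k j => mul_nonneg (pow_nonneg hq0.le _) (by split_ifs <;> simp [hy]))
    simp only [Finset.prod_mul_distrib, prod_pow_count, Nat.add_sub_cancel, prod_ite_count hM,
      ← Finset.mul_sum] at h
    refine h.trans ?_
    have hsum : ∑ k ∈ range M, q ^ (k + 1) =
        ∑ k ∈ range n, if k < M then q ^ (k + 1) else 0 := by
      rw [← Finset.sum_filter]
      congr 1
      ext k
      simp only [Finset.mem_filter, mem_range]
      omega
    calc _ ≤ ∏ k ∈ range n, exp (-log (1 - q ^ (k + 1)) +
          (y - 1) * if k < M then q ^ (k + 1) else 0) := by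
          refine Finset.prod_le_prod (fun k _ => Finset.sum_nonneg fun j _ =>
            mul_nonneg (pow_nonneg hq0.le _) (by split_ifs <;> simp [hy])) fun k _ => ?_
          have hQ1 := exp_neg_pow_lt_one hs k
          have hQ0 : 0 ≤ q ^ (k + 1) := pow_nonneg hq0.le _
          have hpos : 0 < 1 - q ^ (k + 1) := by linarith
          rw [exp_add, exp_neg, exp_log hpos]
          simp only [pow_mul]
          by_cases hk : k < M
          · simp only [hk, true_and, if_true]
            refine (geom_weight_le hQ0 hQ1 hy n).trans ?_
            rw [div_eq_inv_mul]
            refine mul_le_mul_of_nonneg_left ?_ (inv_nonneg.2 hpos.le)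
            rw [add_comm]
            exact add_one_le_exp _
          · simp only [hk, false_and, if_false, mul_zero, exp_zero]
            simpa [div_eq_inv_mul] using geom_weight_le hQ0 hQ1 zero_le_one n
      _ = exp (∑ k ∈ range n, -log (1 - q ^ (k + 1)) +
          (y - 1) * ∑ k ∈ range M, q ^ (k + 1)) := by
          rw [← exp_sum, Finset.sum_add_distrib, hsum, Finset.mul_sum]
      _ ≤ _ := exp_le_exp.2 (by gcongr; exact log_euler_le hs n)
  calc ∑ p : Nat.Partition n, y ^ smallParts M p
      = exp (s * n) * (q ^ n * ∑ p : Nat.Partition n, y ^ smallParts M p) := by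
        rw [← mul_assoc, mul_comm (exp _), hqn, one_mul]
    _ ≤ exp (s * n) * exp (π ^ 2 / 6 / s + (y - 1) * ∑ k ∈ range M, q ^ (k + 1)) := by gcongr
    _ = _ := by rw [← exp_add]; ring_nf

/-! ### Logarithmic asymptotics of the number of partitions -/

/-- Half the constant of the exponential growth in `√n` of the number of partitions of `n`. -/
noncomputable def growthRate : ℝ := π / √6

theorem growthRate_pos : 0 < growthRate := by
  have := pi_pos
  unfold growthRate
  positivity

theorem growthRate_sq : growthRate ^ 2 = π ^ 2 / 6 := by
  rw [growthRate, div_pow, sq_sqrt (by norm_num)]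

theorem card_partition_le {m : ℕ} (hm : 0 < m) :
    (Fintype.card (Nat.Partition m) : ℝ) ≤ exp (2 * growthRate * √m) := by
  have hm' : 0 < √(m : ℝ) := sqrt_pos.2 (Nat.cast_pos.2 hm)
  -- This `s` minimizes `π ^ 2 / 6 / s + s * m`.
  have h := sum_pow_smallParts_le (div_pos growthRate_pos hm') zero_le_one (Nat.zero_le m)
  simp only [one_pow, Finset.sum_const, Finset.card_univ, nsmul_eq_mul, mul_one, sub_self,
    zero_mul, add_zero] at h
  refine h.trans (exp_le_exp.2 (le_of_eq ?_))
  have hr := growthRate_pos.ne'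
  rw [← growthRate_sq]
  nth_rewrite 3 [← sq_sqrt (Nat.cast_nonneg (α := ℝ) m)]
  field_simp
  ring

/-- The sum equals `(1 - exp (-s M)) / (exp s - 1)`, and `s / (exp s - 1) → 1`. -/
theorem tendsto_mul_geom {ι : Type*} {l : Filter ι} {s : ι → ℝ} {M : ι → ℕ} {L : ℝ}
    (hs : ∀ᶠ i in l, 0 < s i) (hs0 : Tendsto s l (𝓝 0))
    (hL : Tendsto (fun i => exp (-(s i * M i))) l (𝓝 L)) :
    Tendsto (fun i => s i * ∑ k ∈ range (M i), exp (-s i) ^ (k + 1)) l (𝓝 (1 - L)) := by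
  have hslope : Tendsto (fun x : ℝ => x⁻¹ * (exp x - 1)) (𝓝[≠] 0) (𝓝 1) := by
    have := hasDerivAt_iff_tendsto_slope_zero.1 (hasDerivAt_exp 0)
    simpa using this
  have h1 : Tendsto (fun i => s i) l (𝓝[≠] 0) :=
    tendsto_nhdsWithin_iff.2 ⟨hs0, hs.mono fun i hi => hi.ne'⟩
  have h2 := ((hslope.comp h1).inv₀ one_ne_zero).mul (hL.const_sub 1)
  rw [inv_one, one_mul] at h2
  refine h2.congr' (hs.mono fun i hi => ?_)
  beta_reduce
  have h3 : exp (-s i) < 1 := exp_lt_one_iff.2 (neg_lt_zero.2 hi)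
  rw [sum_geom_succ_eq h3, exp_neg_div_one_sub, ← exp_nat_mul]
  simp only [Function.comp, mul_inv, inv_inv]
  rw [mul_assoc]
  congr 4
  ring

theorem tendsto_sqrt_natCast : Tendsto (fun n : ℕ => √(n : ℝ)) atTop atTop :=
  tendsto_sqrt_atTop.comp tendsto_natCast_atTop_atTop

theorem tendsto_div_sqrt (a : ℝ) : Tendsto (fun n : ℕ => a / √(n : ℝ)) atTop (𝓝 0) :=
  tendsto_const_nhds.div_atTop tendsto_sqrt_natCast

theorem div_sqrt_mul_self (a : ℝ) (n : ℕ) : a / √(n : ℝ) * n = a * √(n : ℝ) := by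
  rcases Nat.eq_zero_or_pos n with rfl | hn
  · simp
  · have : 0 < √(n : ℝ) := sqrt_pos.2 (Nat.cast_pos.2 hn)
    nth_rewrite 2 [← sq_sqrt (Nat.cast_nonneg (α := ℝ) n)]
    field_simp

theorem tendsto_exp_neg_mul_sqrt {a : ℝ} (ha : 0 < a) :
    Tendsto (fun n : ℕ => exp (-(a * √(n : ℝ)))) atTop (𝓝 0) :=
  tendsto_exp_neg_atTop_nhds_zero.comp (tendsto_sqrt_natCast.const_mul_atTop ha)

theorem tendsto_pow_mul_exp_neg_sqrt {a : ℝ} (ha : 0 < a) (d : ℕ) :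
    Tendsto (fun n : ℕ => (n : ℝ) ^ d * exp (-(a * √(n : ℝ)))) atTop (𝓝 0) := by
  have h := (tendsto_rpow_mul_exp_neg_mul_atTop_nhds_zero (2 * d : ℕ) a ha).comp
    tendsto_sqrt_natCast
  refine h.congr fun n => ?_
  simp only [Function.comp, rpow_natCast]
  rw [pow_mul, sq_sqrt (Nat.cast_nonneg n), neg_mul]

/-- The lower half of the asymptotics of `∏ (1 - q ^ k)⁻¹`, for a finite truncation. -/
theorem eventually_exp_le_prod_geom {a c : ℝ} (ha : 0 < a) (hc : c < π ^ 2 / 6 / a) :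
    ∀ᶠ n : ℕ in atTop, exp (c * √(n : ℝ)) ≤
      ∏ k ∈ range n, ∑ j ∈ range (n + 1), exp (-(a / √(n : ℝ))) ^ ((k + 1) * j) := by
  obtain ⟨c', hcc', hc'⟩ := exists_between hc
  obtain ⟨J, hJ⟩ := (((hasSum_inv_succ_sq.div_const a).tendsto_sum_nat).eventually
    (lt_mem_nhds hc')).exists
  have hlim : Tendsto (fun n : ℕ => (1 / √(n : ℝ)) * ∑ j ∈ range J,
      (∑ k ∈ range n, exp (-(a / √(n : ℝ) * (j + 1))) ^ (k + 1)) / ((j : ℝ) + 1)) atTop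
      (𝓝 (∑ j ∈ range J, 1 / ((j : ℝ) + 1) ^ 2 / a)) := by
    simp only [Finset.mul_sum _ _ (1 / √_)]
    refine tendsto_finsetSum _ fun j _ => ?_
    have hj : (0 : ℝ) < j + 1 := by positivity
    have haj := mul_pos ha hj
    have h := tendsto_mul_geom (l := atTop) (s := fun n : ℕ => a / √(n : ℝ) * (j + 1))
      (M := fun n => n) (L := 0)
      ((eventually_gt_atTop 0).mono fun n hn => by positivity)
      (by simpa using (tendsto_div_sqrt a).mul_const ((j : ℝ) + 1))
      ((tendsto_exp_neg_mul_sqrt haj).congr fun n => by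
        rw [mul_right_comm (a / _), div_sqrt_mul_self, mul_right_comm])
    have h' := h.const_mul (1 / (a * ((j : ℝ) + 1) ^ 2))
    rw [show 1 / (a * ((j : ℝ) + 1) ^ 2) * (1 - 0) = 1 / ((j : ℝ) + 1) ^ 2 / a by field_simp; simp]
      at h'
    refine h'.congr fun n => ?_
    field_simp
  have htrunc : ∀ᶠ n : ℕ in atTop, (n : ℝ) ^ 1 * exp (-(a * √(n : ℝ))) < 1 / 2 :=
    (tendsto_pow_mul_exp_neg_sqrt ha 1).eventually (gt_mem_nhds (by norm_num))
  have hhalf : ∀ᶠ n : ℕ in atTop, exp (-((c' - c) * √(n : ℝ))) < 1 / 2 :=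
    (tendsto_exp_neg_mul_sqrt (sub_pos.2 hcc')).eventually (gt_mem_nhds (by norm_num))
  filter_upwards [hlim.eventually (lt_mem_nhds hJ), htrunc, hhalf, eventually_gt_atTop 0]
    with n h1 h2 h3 hn
  have hsq : 0 < √(n : ℝ) := sqrt_pos.2 (Nat.cast_pos.2 hn)
  set s := a / √(n : ℝ) with hs
  have hspos : 0 < s := div_pos ha hsq
  -- Truncating each geometric series costs a factor of at least `1 - q ^ n`; by Bernoulli all `n`
  -- of them together cost at most a factor 2.
  have hfac : ∀ k ∈ range n, exp (-log (1 - exp (-s) ^ (k + 1))) * (1 - exp (-s) ^ n) ≤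
      ∑ j ∈ range (n + 1), exp (-s) ^ ((k + 1) * j) := by
    intro k _
    have hQ := exp_neg_pow_lt_one hspos k
    have hQ' : 0 < 1 - exp (-s) ^ (k + 1) := by linarith
    simp only [pow_mul]
    rw [geom_sum_eq hQ.ne, exp_neg, exp_log hQ', ← neg_div_neg_eq, neg_sub, neg_sub,
      div_eq_inv_mul]
    refine mul_le_mul_of_nonneg_left (sub_le_sub_left ?_ _) (inv_nonneg.2 hQ'.le)
    rw [← pow_mul]
    refine pow_le_pow_of_le_one (exp_pos _).le (exp_lt_one_iff.2 (neg_lt_zero.2 hspos)).le ?_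
    nlinarith
  have hqn : exp (-s) ^ n = exp (-(a * √(n : ℝ))) := by
    rw [← exp_nat_mul, ← div_sqrt_mul_self]
    congr 1
    ring
  have hq1 : exp (-s) ^ n ≤ 1 :=
    pow_le_one₀ (exp_pos _).le (exp_lt_one_iff.2 (neg_lt_zero.2 hspos)).le
  have hbern : 1 / 2 ≤ (1 - exp (-s) ^ n) ^ n := by
    have := one_add_mul_le_pow (a := -exp (-s) ^ n) (by linarith) n
    rw [hqn] at this ⊢
    rw [← sub_eq_add_neg] at this
    refine le_trans ?_ this
    linarith
  have hlog : c' * √(n : ℝ) ≤ ∑ k ∈ range n, -log (1 - exp (-s) ^ (k + 1)) := by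
    refine le_trans ?_ (le_log_euler hspos n J)
    rw [one_div_mul_eq_div, lt_div_iff₀ hsq] at h1
    exact h1.le
  calc exp (c * √(n : ℝ)) = exp (c' * √(n : ℝ)) * exp (-((c' - c) * √(n : ℝ))) := by
        rw [← exp_add]
        ring_nf
    _ ≤ exp (∑ k ∈ range n, -log (1 - exp (-s) ^ (k + 1))) * (1 - exp (-s) ^ n) ^ n :=
        mul_le_mul (exp_le_exp.2 hlog) (h3.le.trans hbern) (exp_pos _).le (exp_pos _).le
    _ = ∏ k ∈ range n, (exp (-log (1 - exp (-s) ^ (k + 1))) * (1 - exp (-s) ^ n)) := by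
        rw [Finset.prod_mul_distrib, exp_sum, Finset.prod_const, card_range]
    _ ≤ _ := Finset.prod_le_prod (fun k _ => mul_nonneg (exp_pos _).le (by linarith)) hfac

/-- The lower half of the logarithmic asymptotics of the number of partitions. -/
theorem eventually_exp_le_card_partition {δ : ℝ} (hδ : 0 < δ) (hδ' : δ < 1 / 2) :
    ∀ᶠ n : ℕ in atTop,
      exp (2 * growthRate * (1 - 2 * δ) * √(n : ℝ)) ≤ Fintype.card (Nat.Partition n) := by
  have hr := growthRate_pos
  have h1δ : 0 < 1 - δ := by linarith
  -- Tilting slightly more than the optimum `growthRate` puts the dominant size near `(1 - δ) ^ 2 *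
  -- n`, safely below `n`.
  set a := growthRate / (1 - δ) with ha
  have hapos : 0 < a := div_pos hr h1δ
  -- Chosen so that `2 * η = a * δ ^ 2`, which matches the completed square in `hwδ`.
  set η := growthRate * δ ^ 2 / (1 - δ) / 2 with hη
  have hηpos : 0 < η := by positivity
  have hKa : π ^ 2 / 6 / a = growthRate * (1 - δ) := by
    rw [← growthRate_sq, ha]
    field_simp
  have hpoly : ∀ᶠ n : ℕ in atTop,
      (n : ℝ) ^ 3 * exp (-(η * √(n : ℝ))) + exp (-(η * √(n : ℝ))) < 1 := by
    have := (tendsto_pow_mul_exp_neg_sqrt hηpos 3).add (tendsto_exp_neg_mul_sqrt hηpos)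
    exact this.eventually (gt_mem_nhds (by norm_num))
  have hbig : ∀ᶠ n : ℕ in atTop, 1 < growthRate * (1 - δ) * √(n : ℝ) - 2 * η * √(n : ℝ) := by
    have hpos : 0 < growthRate * (1 - δ) - 2 * η := by
      have : growthRate * (1 - δ) - 2 * η = growthRate * (1 - 2 * δ) / (1 - δ) := by
        rw [hη]
        field_simp
        ring
      rw [this]
      exact div_pos (mul_pos hr (by linarith)) h1δ
    refine ((tendsto_sqrt_natCast.const_mul_atTop hpos).eventually_gt_atTop 1).mono fun n hn => ?_
    linarith
  filter_upwards [eventually_exp_le_prod_geom (c := growthRate * (1 - δ) - η) hapos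
    (by rw [hKa]; linarith), hpoly, hbig, eventually_gt_atTop 0] with n h1 h2 h3 hn
  set S := √(n : ℝ) with hS
  have hSpos : 0 < S := sqrt_pos.2 (Nat.cast_pos.2 hn)
  -- Pigeonhole: some one of the `n ^ 3 + 1` terms is large, the polynomial factor being absorbed by
  -- `exp (-(η * S))`.
  obtain ⟨m, hm⟩ : ∃ m : ℕ, exp ((growthRate * (1 - δ) - 2 * η) * S) ≤
      Fintype.card (Nat.Partition m) * exp (-(a / S)) ^ m := by
    by_contra! hcon
    have hsum := h1.trans (prod_geom_le_sum_card_partition n (exp_pos (-(a / S))).le)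
    have hle := hsum.trans (Finset.sum_le_card_nsmul _ _ _ fun m _ => (hcon m).le)
    rw [card_range, nsmul_eq_mul] at hle
    have hsplit : exp ((growthRate * (1 - δ) - 2 * η) * S) =
        exp ((growthRate * (1 - δ) - η) * S) * exp (-(η * S)) := by
      rw [← exp_add]
      ring_nf
    rw [hsplit] at hle
    push_cast at hle
    nlinarith [exp_pos ((growthRate * (1 - δ) - η) * S)]
  have hqm : exp (-(a / S)) ^ m = exp (-(a / S * m)) := by
    rw [← exp_nat_mul]
    congr 1
    ring
  rw [hqm] at hm
  have hmpos : 0 < m := by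
    refine Nat.pos_of_ne_zero fun h0 => ?_
    subst h0
    simp only [Nat.cast_zero, mul_zero, neg_zero, exp_zero, mul_one,
      show Fintype.card (Nat.Partition 0) = 1 from Fintype.card_unique, Nat.cast_one] at hm
    have := exp_le_one_iff.1 hm
    linarith
  set w := √(m : ℝ) / S with hw
  have hwm : √(m : ℝ) = w * S := by rw [hw]; field_simp
  have hasm : a / S * m = a * w ^ 2 * S := by
    rw [← sq_sqrt (Nat.cast_nonneg (α := ℝ) m), hwm]
    field_simp
  have hw0 : 0 ≤ w := by positivity
  -- The upper bound for the number of partitions of `m` locates `m`: `1 - 2 * δ ≤ w ≤ 1`. Hence `m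
  -- ≤ n`, and monotonicity transfers the bound from `m` to `n`.
  have hwδ : (w - (1 - δ)) ^ 2 ≤ δ ^ 2 := by
    have hexp := hm.trans (mul_le_mul_of_nonneg_right (card_partition_le hmpos) (exp_pos _).le)
    rw [← exp_add, exp_le_exp, hasm, hwm] at hexp
    have hdiv : growthRate * (1 - δ) - 2 * η ≤ 2 * growthRate * w - a * w ^ 2 := by
      refine le_of_mul_le_mul_right ?_ hSpos
      linarith
    have hfac : growthRate / (1 - δ) * ((w - (1 - δ)) ^ 2) ≤ growthRate / (1 - δ) * δ ^ 2 := by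
      have e1 : growthRate / (1 - δ) * ((w - (1 - δ)) ^ 2) =
          a * w ^ 2 - 2 * growthRate * w + growthRate * (1 - δ) := by
        rw [ha]
        field_simp
        ring
      have e2 : growthRate / (1 - δ) * δ ^ 2 = 2 * η := by
        rw [hη]
        field_simp
      rw [e1, e2]
      linarith
    exact le_of_mul_le_mul_left hfac (div_pos hr h1δ)
  obtain ⟨hlow, hhigh⟩ := abs_le.1 (abs_le_of_sq_le_sq hwδ hδ.le)
  have hmn : m ≤ n := by
    have : √(m : ℝ) ≤ S := by rw [hwm]; nlinarith
    exact Nat.cast_le.1 ((sqrt_le_sqrt_iff (Nat.cast_nonneg n)).1 this)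
  calc exp (2 * growthRate * (1 - 2 * δ) * S)
      ≤ exp ((growthRate * (1 - δ) - 2 * η) * S + a / S * m) := by
        refine exp_le_exp.2 ?_
        rw [hasm, ← add_mul]
        refine mul_le_mul_of_nonneg_right ?_ hSpos.le
        have hsq : (1 - 2 * δ) ^ 2 ≤ w ^ 2 := pow_le_pow_left₀ (by linarith) (by linarith) 2
        calc 2 * growthRate * (1 - 2 * δ)
            = growthRate * (1 - δ) - 2 * η + a * (1 - 2 * δ) ^ 2 := by
              rw [hη, ha]
              field_simp
              ring
          _ ≤ _ := by gcongr
    _ ≤ Fintype.card (Nat.Partition m) := by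
        rw [exp_add]
        refine (mul_le_mul_of_nonneg_right hm (exp_pos _).le).trans (le_of_eq ?_)
        rw [mul_assoc, ← exp_add, neg_add_cancel, exp_zero, mul_one]
    _ ≤ _ := Nat.cast_le.2 (card_partition_mono hmn)

/-! ### Concentration under the uniform distribution -/

/-- The expected number of distinct part sizes at most `M` when the multiplicities of the parts are
independent geometric variables and the expected sum of the parts is close to `n`. -/
noncomputable def meanSmallParts (n M : ℕ) : ℝ :=
  ∑ k ∈ range M, exp (-(growthRate / √(n : ℝ))) ^ (k + 1)

/-- The proportion of the partitions of `n` which satisfy `A`. -/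
noncomputable def proportion (n : ℕ) (A : Nat.Partition n → Prop) : ℝ :=
  letI := Classical.decPred A
  (#{p : Nat.Partition n | A p} : ℝ) / Fintype.card (Nat.Partition n)

theorem proportion_nonneg (n : ℕ) (A : Nat.Partition n → Prop) : 0 ≤ proportion n A := by
  unfold proportion
  positivity

theorem proportion_le_add {n : ℕ} {A B C : Nat.Partition n → Prop}
    (h : ∀ p, A p → B p ∨ C p) : proportion n A ≤ proportion n B + proportion n C := by
  classical
  unfold proportion
  rw [← add_div]
  refine div_le_div_of_nonneg_right ?_ (card_partition_pos n).le
  rw [← Nat.cast_add, Nat.cast_le]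
  refine (Finset.card_le_card fun p hp => ?_).trans (Finset.card_union_le _ _)
  simp only [Finset.mem_union, Finset.mem_filter, mem_univ, true_and] at hp ⊢
  exact h p hp

theorem relative_entropy_pos {z : ℝ} (hz : 0 < z) (hz1 : z ≠ 1) : 0 < z * log z - z + 1 := by
  have h := log_lt_sub_one_of_pos (inv_pos.2 hz) (by simpa using hz1)
  rw [log_inv] at h
  have h' := mul_lt_mul_of_pos_left h hz
  rw [mul_sub, mul_inv_cancel₀ hz.ne'] at h'
  linarith

/-- The Chernoff bound for the number of small part sizes, under the uniform distribution. -/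
theorem proportion_le_exp {n M : ℕ} (hn : 0 < n) (hM : M ≤ n) {z : ℝ} (hz : 0 < z) :
    proportion n (fun p => log z * (z * meanSmallParts n M) ≤ log z * smallParts M p) ≤
      exp (2 * growthRate * √(n : ℝ) - (z * log z - z + 1) * meanSmallParts n M) /
        Fintype.card (Nat.Partition n) := by
  classical
  unfold proportion
  refine div_le_div_of_nonneg_right ?_ (card_partition_pos n).le
  have hsq : 0 < √(n : ℝ) := sqrt_pos.2 (Nat.cast_pos.2 hn)
  have hr := growthRate_pos
  have hexp : π ^ 2 / 6 / (growthRate / √(n : ℝ)) + growthRate / √(n : ℝ) * n =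
      2 * growthRate * √(n : ℝ) := by
    rw [← growthRate_sq, div_sqrt_mul_self]
    field_simp
    ring
  have hsum := sum_pow_smallParts_le (div_pos hr hsq) hz.le hM
  rw [hexp, ← meanSmallParts] at hsum
  set μ := meanSmallParts n M
  have hpow : ∀ j : ℕ, z ^ j = exp (log z * j) := fun j => by
    rw [mul_comm, exp_nat_mul, exp_log hz]
  have hmarkov : (#{p : Nat.Partition n | log z * (z * μ) ≤ log z * smallParts M p} : ℝ) *
      exp (log z * (z * μ)) ≤ ∑ p : Nat.Partition n, z ^ smallParts M p := by
    rw [← nsmul_eq_mul]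
    refine (Finset.card_nsmul_le_sum _ (fun p => z ^ smallParts M p) _ fun p hp => ?_).trans
      (Finset.sum_le_sum_of_subset_of_nonneg (Finset.filter_subset _ _) fun p _ _ =>
        pow_nonneg hz.le _)
    rw [hpow, exp_le_exp]
    exact (Finset.mem_filter.1 hp).2
  have h := hmarkov.trans hsum
  rw [← le_div_iff₀ (exp_pos _), ← exp_sub] at h
  refine (le_of_eq ?_).trans (h.trans (le_of_eq ?_))
  · congr!
  · ring_nf

/-- The factor `log z` treats both tails at once: the event is the upper tail if `z > 1` and the
lower tail if `z < 1`. -/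
theorem tendsto_proportion_chernoff {M : ℕ → ℕ} (hM : ∀ᶠ n in atTop, M n ≤ n) {τ : ℝ} (hτ : 0 < τ)
    (hmean : Tendsto (fun n : ℕ => growthRate / √(n : ℝ) * meanSmallParts n (M n)) atTop (𝓝 τ))
    {z : ℝ} (hz : 0 < z) (hz1 : z ≠ 1) :
    Tendsto (fun n => proportion n fun p =>
      log z * (z * meanSmallParts n (M n)) ≤ log z * smallParts (M n) p) atTop (𝓝 0) := by
  have hr := growthRate_pos
  have hh := relative_entropy_pos hz hz1
  set h := z * log z - z + 1
  -- Eventually the Chernoff gain is at least `2 * c * √n`, and `δ` keeps the loss `4 * growthRate *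
  -- δ * √n` from the partition count below `c * √n`; the net bound is `exp (-(c * √n))`.
  set c := h * (τ / 2 / growthRate) / 2 with hc
  have hcpos : 0 < c := by positivity
  set δ := min (1 / 4) (c / (4 * growthRate)) with hδ
  have hδpos : 0 < δ := lt_min (by norm_num) (by positivity)
  have hδlt : δ < 1 / 2 := (min_le_left _ _).trans_lt (by norm_num)
  have hδc : 4 * growthRate * δ ≤ c := by
    have := min_le_right (1 / 4 : ℝ) (c / (4 * growthRate))
    rw [← hδ, le_div_iff₀ (by positivity)] at this
    linarith
  refine squeeze_zero' (Eventually.of_forall fun n => proportion_nonneg n _) ?_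
    (tendsto_exp_neg_mul_sqrt hcpos)
  filter_upwards [hM, hmean.eventually (lt_mem_nhds (half_lt_self hτ)),
    eventually_exp_le_card_partition hδpos hδlt, eventually_gt_atTop 0] with n h1 h2 h3 hn
  have hsq : 0 < √(n : ℝ) := sqrt_pos.2 (Nat.cast_pos.2 hn)
  refine (proportion_le_exp hn h1 hz).trans ?_
  rw [div_le_iff₀ (card_partition_pos n)]
  refine le_trans ?_ (mul_le_mul_of_nonneg_left h3 (exp_pos _).le)
  rw [← exp_add, exp_le_exp]
  have hμ : τ / 2 / growthRate * √(n : ℝ) ≤ meanSmallParts n (M n) := by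
    rw [div_mul_eq_mul_div, lt_div_iff₀ hsq] at h2
    rw [div_mul_eq_mul_div, div_le_iff₀ hr]
    linarith
  have e1 : 2 * c * √(n : ℝ) ≤ h * meanSmallParts n (M n) := by
    refine le_trans (le_of_eq ?_) (mul_le_mul_of_nonneg_left hμ hh.le)
    rw [hc]
    ring
  have e2 := mul_le_mul_of_nonneg_right hδc hsq.le
  linarith

/-- The number of distinct part sizes at most `M n` is concentrated around its mean. -/
theorem tendsto_proportion_deviation {M : ℕ → ℕ} (hM : ∀ᶠ n in atTop, M n ≤ n) {τ : ℝ} (hτ : 0 < τ)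
    (hmean : Tendsto (fun n : ℕ => growthRate / √(n : ℝ) * meanSmallParts n (M n)) atTop (𝓝 τ))
    {η : ℝ} (hη : 0 < η) (hη1 : η < 1) :
    Tendsto (fun n => proportion n fun p =>
      ¬ ((1 - η) * meanSmallParts n (M n) < smallParts (M n) p ∧
        smallParts (M n) p < (1 + η) * meanSmallParts n (M n))) atTop (𝓝 0) := by
  have hu := tendsto_proportion_chernoff hM hτ hmean (z := 1 + η) (by linarith) (by linarith)
  have hl := tendsto_proportion_chernoff hM hτ hmean (z := 1 - η) (by linarith) (by linarith)
  have hsum := hl.add hu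
  rw [add_zero] at hsum
  refine squeeze_zero (fun n => proportion_nonneg n _) (fun n => proportion_le_add ?_) hsum
  intro p hp
  rw [not_and_or, not_lt, not_lt] at hp
  refine hp.imp (fun h => ?_) fun h => ?_
  · exact mul_le_mul_of_nonpos_left h (log_nonpos (by linarith) (by linarith))
  · exact mul_le_mul_of_nonneg_left h (log_nonneg (by linarith))

/-! ### Averaging the ratio over partitions -/

theorem abs_average_sub_le {n : ℕ} (f : Nat.Partition n → ℝ) {r ε : ℝ} (hε : 0 ≤ ε)
    (A : Nat.Partition n → Prop) (hgood : ∀ p, ¬ A p → |f p - r| ≤ ε)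
    (hbad : ∀ p, |f p - r| ≤ 1) :
    |(∑ p, f p) / Fintype.card (Nat.Partition n) - r| ≤ ε + proportion n A := by
  classical
  have hN := card_partition_pos n
  have e : (∑ p, f p) / Fintype.card (Nat.Partition n) - r =
      (∑ p, (f p - r)) / Fintype.card (Nat.Partition n) := by
    rw [Finset.sum_sub_distrib, Finset.sum_const, Finset.card_univ, nsmul_eq_mul]
    field_simp
  have hA : ε + proportion n A =
      (∑ p, (ε + if A p then 1 else 0)) / Fintype.card (Nat.Partition n) := by
    rw [Finset.sum_add_distrib, Finset.sum_const, Finset.card_univ, nsmul_eq_mul, Finset.sum_boole,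
      proportion]
    field_simp
  rw [e, hA, abs_div, abs_of_pos hN]
  refine div_le_div_of_nonneg_right ((Finset.abs_sum_le_sum_abs _ _).trans
    (Finset.sum_le_sum fun p _ => ?_)) hN.le
  by_cases hp : A p
  · rw [if_pos hp]
    linarith [hbad p]
  · rw [if_neg hp, add_zero]
    exact hgood p hp

theorem smallParts_self {n : ℕ} (p : Nat.Partition n) : smallParts n p = #(distinctParts p) := by
  rw [smallParts, Finset.filter_true_of_mem]
  exact fun k hk => partition_part_le p (Multiset.mem_toFinset.1 hk)

theorem smallParts_le {n : ℕ} (M : ℕ) (p : Nat.Partition n) :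
    smallParts M p ≤ #(distinctParts p) :=
  Finset.card_filter_le _ _

theorem exists_relative_error {r ε : ℝ} (hε : 0 < ε) :
    ∃ η : ℝ, 0 < η ∧ η < 1 ∧ r - ε < (1 - η) / (1 + η) * r ∧ (1 + η) / (1 - η) * r < r + ε := by
  have h1 : Tendsto (fun η : ℝ => (1 - η) / (1 + η) * r) (𝓝[>] 0) (𝓝 r) := by
    have : ContinuousAt (fun η : ℝ => (1 - η) / (1 + η) * r) 0 := by
      fun_prop (disch := norm_num)
    simpa using this.tendsto.mono_left (nhdsWithin_le_nhds (s := Set.Ioi 0))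
  have h2 : Tendsto (fun η : ℝ => (1 + η) / (1 - η) * r) (𝓝[>] 0) (𝓝 r) := by
    have : ContinuousAt (fun η : ℝ => (1 + η) / (1 - η) * r) 0 := by
      fun_prop (disch := norm_num)
    simpa using this.tendsto.mono_left (nhdsWithin_le_nhds (s := Set.Ioi 0))
  obtain ⟨η, ha, hb, hc⟩ := ((h1.eventually (lt_mem_nhds (sub_lt_self r hε))).and
    ((h2.eventually (gt_mem_nhds (lt_add_of_pos_right r hε))).and
      (Ioo_mem_nhdsGT (zero_lt_one (α := ℝ))))).exists
  exact ⟨η, hc.1, hc.2, ha, hb⟩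

/-- Off an event of vanishing proportion both counts are within a factor `1 ± η` of their means, so
the ratio is near `r`; on that event the error is at most 1. -/
theorem tendsto_average_ratio {M : ℕ → ℕ} (hM : ∀ᶠ n in atTop, M n ≤ n) {r : ℝ} (hr : 0 < r)
    (hr1 : r ≤ 1)
    (hmean : Tendsto (fun n : ℕ => growthRate / √(n : ℝ) * meanSmallParts n (M n)) atTop (𝓝 r))
    (htotal : Tendsto (fun n : ℕ => growthRate / √(n : ℝ) * meanSmallParts n n) atTop (𝓝 1)) :
    Tendsto (fun n : ℕ => (∑ p : Nat.Partition n,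
      (smallParts (M n) p : ℝ) / #(distinctParts p)) / Fintype.card (Nat.Partition n))
      atTop (𝓝 r) := by
  rw [Metric.tendsto_nhds]
  intro ε hε
  obtain ⟨η, hη, hη1, hlow, hhigh⟩ := exists_relative_error (r := r) (half_pos hε)
  have hratio : Tendsto (fun n : ℕ => meanSmallParts n (M n) / meanSmallParts n n) atTop (𝓝 r) := by
    have h := hmean.div htotal one_ne_zero
    rw [div_one] at h
    refine h.congr' ((eventually_gt_atTop 0).mono fun n hn => ?_)
    have hsq : 0 < √(n : ℝ) := sqrt_pos.2 (Nat.cast_pos.2 hn)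
    exact mul_div_mul_left _ _ (div_pos growthRate_pos hsq).ne'
  have hdev := (tendsto_proportion_deviation hM hr hmean hη hη1).add
    (tendsto_proportion_deviation (M := fun n => n) (Eventually.of_forall fun n => le_rfl)
      one_pos htotal hη hη1)
  rw [add_zero] at hdev
  filter_upwards [hdev.eventually (gt_mem_nhds (half_pos hε)),
    (hratio.const_mul ((1 - η) / (1 + η))).eventually (lt_mem_nhds hlow),
    (hratio.const_mul ((1 + η) / (1 - η))).eventually (gt_mem_nhds hhigh),
    hmean.eventually (lt_mem_nhds hr), htotal.eventually (lt_mem_nhds one_pos),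
    eventually_gt_atTop 0] with n h1 h2 h3 h4 h5 hn
  have hs : 0 < growthRate / √(n : ℝ) :=
    div_pos growthRate_pos (sqrt_pos.2 (Nat.cast_pos.2 hn))
  have hμ := pos_of_mul_pos_right h4 hs.le
  have hν := pos_of_mul_pos_right h5 hs.le
  set μ := meanSmallParts n (M n)
  set ν := meanSmallParts n n
  have hη' : 0 < 1 - η := by linarith
  rw [Real.dist_eq]
  refine (abs_average_sub_le _ (half_pos hε).le
    (fun p => ¬ ((1 - η) * μ < smallParts (M n) p ∧ smallParts (M n) p < (1 + η) * μ) ∨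
      ¬ ((1 - η) * ν < smallParts n p ∧ smallParts n p < (1 + η) * ν)) ?_ ?_).trans_lt
    ((add_le_add_right (proportion_le_add fun p hp => hp) _).trans_lt (by linarith))
  · intro p hp
    rw [not_or, not_not, not_not, smallParts_self] at hp
    obtain ⟨⟨a1, a2⟩, b1, b2⟩ := hp
    have hD : (0 : ℝ) < #(distinctParts p) := lt_trans (mul_pos hη' hν) b1
    have l1 : (1 - η) / (1 + η) * (μ / ν) ≤ (smallParts (M n) p : ℝ) / #(distinctParts p) := by
      rw [div_mul_div_comm]
      exact div_le_div₀ (Nat.cast_nonneg _) a1.le hD b2.le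
    have l2 : (smallParts (M n) p : ℝ) / #(distinctParts p) ≤ (1 + η) / (1 - η) * (μ / ν) := by
      rw [div_mul_div_comm]
      exact div_le_div₀ (by positivity) a2.le (mul_pos hη' hν) b1.le
    rw [abs_le]
    constructor <;> linarith
  · intro p
    have l1 : (0 : ℝ) ≤ (smallParts (M n) p : ℝ) / #(distinctParts p) := by positivity
    have l2 : (smallParts (M n) p : ℝ) / #(distinctParts p) ≤ 1 :=
      div_le_one_of_le₀ (Nat.cast_le.2 (smallParts_le _ p)) (Nat.cast_nonneg _)
    rw [abs_le]
    constructor <;> linarith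

/-! ### The sampling measure and the limit of the means -/

theorem procedure1Measure_real_partSize_le (n : ℕ+) (M : ℕ) :
    (procedure1Measure n).real {ω | partSize ω ≤ M} =
      (∑ p : Nat.Partition n, (smallParts M p : ℝ) / #(distinctParts p)) /
        Fintype.card (Nat.Partition n) := by
  have hdisc : DiscreteMeasurableSpace (Nat.Partition n) := ⟨fun _ => trivial⟩
  have hS : MeasurableSet {ω : Nat.Partition n × ℕ | partSize ω ≤ M} := .of_discrete
  rw [Measure.real, procedure1Measure, procedure1, PMF.toMeasure_bind_apply _ _ _ hS, tsum_fintype,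
    ENNReal.toReal_sum fun p _ => ENNReal.mul_ne_top (PMF.apply_ne_top _ _) (measure_ne_top _ _),
    Finset.sum_div]
  refine Finset.sum_congr rfl fun p _ => ?_
  have hm : Measurable fun k : ℕ => (p, k) := measurable_from_top
  classical
  have hcard : ∀ [DecidablePred (· ∈ (fun k : ℕ => (p, k)) ⁻¹' {ω | partSize ω ≤ M})],
      #{k ∈ distinctParts p | k ∈ (fun k : ℕ => (p, k)) ⁻¹' {ω | partSize ω ≤ M}} =
        smallParts M p := by
    intro _
    refine congrArg Finset.card (Finset.ext fun k => ?_)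
    rw [Finset.mem_filter, Finset.mem_filter]
    rfl
  rw [PMF.toMeasure_map_apply _ _ _ hm hS,
    PMF.toMeasure_uniformOfFinset_apply _ _ (MeasurableSet.of_discrete), hcard]
  simp [ENNReal.toReal_mul, div_eq_inv_mul]

theorem tendsto_mean_floor {t : ℝ} (ht : 0 < t) :
    Tendsto (fun n : ℕ => growthRate / √(n : ℝ) *
      meanSmallParts n ⌊t / growthRate * √(n : ℝ)⌋₊) atTop (𝓝 (1 - exp (-t))) := by
  have hr := growthRate_pos
  refine tendsto_mul_geom ((eventually_gt_atTop 0).mono fun n hn => ?_) (tendsto_div_sqrt _) ?_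
  · exact div_pos hr (sqrt_pos.2 (Nat.cast_pos.2 hn))
  · have h := ((tendsto_nat_floor_mul_div_atTop (div_pos ht hr).le).comp
      tendsto_sqrt_natCast).const_mul growthRate
    rw [mul_div_cancel₀ _ hr.ne'] at h
    refine (continuous_exp.tendsto _).comp (Tendsto.neg (h.congr fun n => ?_))
    simp only [Function.comp]
    ring

theorem tendsto_mean_total :
    Tendsto (fun n : ℕ => growthRate / √(n : ℝ) * meanSmallParts n n) atTop (𝓝 1) := by
  have hr := growthRate_pos
  rw [← sub_zero (1 : ℝ)]
  refine tendsto_mul_geom ((eventually_gt_atTop 0).mono fun n hn => ?_) (tendsto_div_sqrt _) ?_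
  · exact div_pos hr (sqrt_pos.2 (Nat.cast_pos.2 hn))
  · exact (tendsto_exp_neg_mul_sqrt hr).congr fun n => by rw [div_sqrt_mul_self]

theorem eventually_floor_le (c : ℝ) : ∀ᶠ n : ℕ in atTop, ⌊c * √(n : ℝ)⌋₊ ≤ n := by
  filter_upwards [tendsto_sqrt_natCast.eventually_ge_atTop c] with n hn
  refine Nat.floor_le_of_le ?_
  calc c * √(n : ℝ) ≤ √(n : ℝ) * √(n : ℝ) := mul_le_mul_of_nonneg_right hn (sqrt_nonneg _)
    _ = n := mul_self_sqrt (Nat.cast_nonneg n)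

end PartitionSampling

theorem theorem2 (t : ℝ) (ht : 0 < t) :
    Tendsto
      (fun n : ℕ+ =>
        (PartitionSampling.procedure1Measure n).real
          {ω | Real.pi * (PartitionSampling.partSize ω : ℝ) / √(6 * (n : ℝ)) ≤ t})
      atTop (𝓝 (1 - Real.exp (-t))) := by
  have hlim := PartitionSampling.tendsto_average_ratio
    (PartitionSampling.eventually_floor_le (t / PartitionSampling.growthRate))
    (sub_pos.2 (Real.exp_lt_one_iff.2 (neg_lt_zero.2 ht)))
    (sub_le_self 1 (Real.exp_pos _).le) (PartitionSampling.tendsto_mean_floor ht)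
    PartitionSampling.tendsto_mean_total
  refine (hlim.comp tendsto_PNat_val_atTop_atTop).congr fun n => ?_
  rw [Function.comp, ← PartitionSampling.procedure1Measure_real_partSize_le]
  congr 1
  ext ω
  have hn : 0 < √(n : ℝ) := Real.sqrt_pos.2 (Nat.cast_pos.2 n.pos)
  have h6 : 0 < √(6 : ℝ) := Real.sqrt_pos.2 (by norm_num)
  have hpi := Real.pi_pos
  -- Part sizes are integers, so the event is exactly `partSize ω ≤ ⌊t / growthRate * √n⌋₊`.
  rw [Set.mem_ofPred_eq, Set.mem_ofPred_eq, Real.sqrt_mul (by norm_num), div_le_iff₀ (by positivity),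
    Nat.le_floor_iff (mul_nonneg (div_pos ht PartitionSampling.growthRate_pos).le hn.le),
    PartitionSampling.growthRate, div_div_eq_mul_div, div_mul_eq_mul_div, le_div_iff₀ hpi,
    mul_comm Real.pi, mul_assoc]
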